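/- **Theorem (Universal Approximation).** Let $A\in\mathbb R^{n\times n}$, let $C_i\in\mathbb R^{p\times n}$ $(i\in\mathbb M=\{1,\dots,M\})$, and let $\Phi^w\in\mathbb R^{n\times n}$ and $\Phi^v_i\in\mathbb R^{p\times p}$ $(i\in\mathbb M)$ be symmetric positive definite. These are the data of the linear Gaussian system $x(t+1)=Ax(t)+w(t)$ with process-noise covariance $\Phi^w$, observed at each time through one of the $M$ sensors $y_i(t)=C_ix(t)+v_i(t)$ with measurement-noise covariances $\Phi_i^v$. Let $\mathcal A$ be the set of symmetric positive semidefinite real $n\times n$ matrices, and for $i\in\mathbb M$ and $Q\in\mathcal A$ let $$\rho_i(Q)=\Phi^w+AQA^T-AQC_i^T\left(C_iQC_i^T+\Phi_i^v\right)^{-1}C_iQA^T .$$ A schedule is a sequence $\sigma:\{0,1,2,\dots\}\to\mathbb M$. For $\phi\in\mathcal A$, the prediction-error covariance trajectory of $\sigma$ started at $\phi$ is given by the Riccati recursion $\Sigma_0^\sigma(\phi)=\phi$, $\Sigma_{t+1}^\sigma(\phi)=\rho_{\sigma(t)}(\Sigma_t^\sigma(\phi))$. The schedule $\sigma$ is called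 feasible if for every $\phi\in\mathcal A$ there is $\beta<\infty$ such that $\Sigma_t^\sigma(\phi)\preceq\beta I_n$ for all $t\ge 0$. The infinite-horizon average-per-stage cost is $$\bar J_\infty(\sigma;\phi)=\limsup_{N\to\infty}\frac1N\sum_{t=1}^N\operatorname{tr}\Sigma_t^\sigma(\phi).$$ Then for every feasible schedule $\sigma$ and every $\delta>0$ there exist an integer $N\ge 1$ and a feasible schedule $\tilde\sigma$ that is periodic with period $N$, i.e. $\tilde\sigma(t+N)=\tilde\sigma(t)$ for all $t\ge0$, such that $$\left|\bar J_\infty(\tilde\sigma;\phi)-\bar J_\infty(\sigma;\psi)\right|<\delta\qquad\text{for all }\phi,\psi\in\mathcal A .$$ -/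

import Mathlib

open Filter
open scoped Matrix

noncomputable section

/-- The data of the linear system `x(t+1) = A x(t) + w(t)` with state in `ℝⁿ`, observed by `M`
sensors `yᵢ(t) = Cᵢ x(t) + vᵢ(t)` with values in `ℝᵖ`. `W` is the covariance matrix of the process
noise `w(t)` and `V i` the covariance matrix of the measurement noise `vᵢ(t)`. -/
structure SensorSystem (n p M : ℕ) where
  A : Matrix (Fin n) (Fin n) ℝ
  C : Fin M → Matrix (Fin p) (Fin n) ℝ
  W : Matrix (Fin n) (Fin n) ℝ
  V : Fin M → Matrix (Fin p) (Fin p) ℝ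

namespace SensorSystem

variable {n p M : ℕ}

/-- The Riccati mapping of sensor `i`. -/
def riccati (S : SensorSystem n p M) (i : Fin M) (Q : Matrix (Fin n) (Fin n) ℝ) :
    Matrix (Fin n) (Fin n) ℝ :=
  S.W + S.A * Q * S.Aᵀ -
    S.A * Q * (S.C i)ᵀ * (S.C i * Q * (S.C i)ᵀ + S.V i)⁻¹ * (S.C i) * Q * S.Aᵀ

/-- The covariance trajectory under the schedule `σ`, started at the initial covariance `φ`: the
covariance of the one-step prediction error, given by the Riccati recursion. -/
def covariance (S : SensorSystem n p M) (σ : ℕ → Fin M) (φ : Matrix (Fin n) (Fin n) ℝ) :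
    ℕ → Matrix (Fin n) (Fin n) ℝ
  | 0 => φ
  | t + 1 => S.riccati (σ t) (covariance S σ φ t)

/-- A schedule is feasible if, from every positive semidefinite initial covariance, there is a
`β : ℝ` with `Σ_t ⪯ β Iₙ` for all `t`. -/
def Feasible (S : SensorSystem n p M) (σ : ℕ → Fin M) : Prop :=
  ∀ φ : Matrix (Fin n) (Fin n) ℝ, φ.PosSemidef →
    ∃ β : ℝ, ∀ t : ℕ,
      (β • (1 : Matrix (Fin n) (Fin n) ℝ) - S.covariance σ φ t).PosSemidef

/-- The `N`-horizon total estimation error. -/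
def totalCost (S : SensorSystem n p M) (N : ℕ) (σ : ℕ → Fin M)
    (φ : Matrix (Fin n) (Fin n) ℝ) : ℝ :=
  ∑ t ∈ Finset.Icc 1 N, (S.covariance σ φ t).trace

/-- The `N`-horizon average-per-stage estimation error. -/
def averageCost (S : SensorSystem n p M) (N : ℕ) (σ : ℕ → Fin M)
    (φ : Matrix (Fin n) (Fin n) ℝ) : ℝ :=
  1 / (N : ℝ) * S.totalCost N σ φ

/-- The infinite-horizon average-per-stage cost. For a feasible schedule the averages form a bounded
sequence, so that this real-valued limsup is the genuine one. -/
def infiniteCost (S : SensorSystem n p M) (σ : ℕ → Fin M)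
    (φ : Matrix (Fin n) (Fin n) ℝ) : ℝ :=
  limsup (fun N : ℕ => S.averageCost N σ φ) atTop

end SensorSystem

end

/-! The Riccati map is the minimum, over predictor gains, of updates that are affine and monotone in
the covariance, with constant term at least `W`. Hence `Q ≤ (1 + κ) • P` gives `ρ(Q) ≤ (1 + κ) •
ρ(P) - κ • W`, and since `W` is positive definite and a feasible trajectory is bounded, the gap `κ`
shrinks by a fixed factor at each step (`riccati_le_smul_riccati`). The initial covariance is thus
forgotten geometrically, and it changes the total cost by at most a constant `K`, whatever the
horizon (`exists_abs_totalCost_sub_le`).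

Repeating a prefix of length `N` restarts the prefix from a new covariance in each period. For large
`N` these covariances stay in a fixed ball, so a period costs at most `K` more or less than the
prefix, and the average moves by at most `K / N` (`exists_repeatPrefix_bound`). Arbitrarily long
prefixes have average cost close to the limsup, so one of them suffices. -/

namespace Matrix

open scoped MatrixOrder

variable {m n : ℕ}

/-! ### Loewner order on real matrices. -/

theorem smul_le_smul_right_of_posSemidef {P : Matrix (Fin n) (Fin n) ℝ} (hP : 0 ≤ P) {a b : ℝ}
    (h : a ≤ b) : a • P ≤ b • P := by
  rw [le_iff, ← sub_smul]
  exact (nonneg_iff_posSemidef.1 hP).smul (sub_nonneg.2 h)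

theorem smul_le_smul_left_of_nonneg {P Q : Matrix (Fin n) (Fin n) ℝ} (hPQ : P ≤ Q) {a : ℝ}
    (h : 0 ≤ a) : a • P ≤ a • Q := by
  rw [le_iff, ← smul_sub]
  exact (le_iff.1 hPQ).smul h

theorem congruence_le_congruence {P Q : Matrix (Fin n) (Fin n) ℝ} (hPQ : P ≤ Q)
    (B : Matrix (Fin m) (Fin n) ℝ) : B * P * Bᵀ ≤ B * Q * Bᵀ := by
  rw [le_iff, ← Matrix.sub_mul, ← Matrix.mul_sub, ← conjTranspose_eq_transpose_of_trivial]
  exact (le_iff.1 hPQ).mul_mul_conjTranspose_same B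

theorem congruence_nonneg {P : Matrix (Fin n) (Fin n) ℝ} (hP : 0 ≤ P)
    (B : Matrix (Fin m) (Fin n) ℝ) : 0 ≤ B * P * Bᵀ := by
  simpa using congruence_le_congruence hP B

theorem trace_le_trace {P Q : Matrix (Fin n) (Fin n) ℝ} (hPQ : P ≤ Q) : P.trace ≤ Q.trace := by
  have := (le_iff.1 hPQ).trace_nonneg
  rw [trace_sub] at this
  linarith

theorem trace_le_of_le_smul_one {P : Matrix (Fin n) (Fin n) ℝ} {β : ℝ}
    (h : P ≤ β • (1 : Matrix (Fin n) (Fin n) ℝ)) : P.trace ≤ β * n := by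
  simpa using trace_le_trace h

theorem exists_transpose_mul_self_le_smul_one (D : Matrix (Fin m) (Fin n) ℝ) :
    ∃ c : ℝ, 0 < c ∧ Dᵀ * D ≤ c • (1 : Matrix (Fin n) (Fin n) ℝ) := by
  have hs : 0 ≤ ∑ i, ∑ j, D i j ^ 2 :=
    Finset.sum_nonneg fun i _ => Finset.sum_nonneg fun j _ => sq_nonneg _
  refine ⟨1 + ∑ i, ∑ j, D i j ^ 2, by linarith, ?_⟩
  rw [le_iff]
  refine .of_dotProduct_mulVec_nonneg ?_ fun x => ?_
  · simp [IsHermitian, conjTranspose_eq_transpose_of_trivial]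
  · have key : (D *ᵥ x) ⬝ᵥ (D *ᵥ x) ≤ (∑ i, ∑ j, D i j ^ 2) * (x ⬝ᵥ x) := by
      simp only [dotProduct, Finset.sum_mul (s := (Finset.univ : Finset (Fin m)))]
      refine Finset.sum_le_sum fun i _ => ?_
      have := Finset.sum_mul_sq_le_sq_mul_sq Finset.univ (fun j => D i j) x
      simpa [mulVec, dotProduct, ← sq] using this
    have hx : 0 ≤ x ⬝ᵥ x := Finset.sum_nonneg fun i _ => mul_self_nonneg _
    rw [star_trivial, sub_mulVec, dotProduct_sub, smul_mulVec, one_mulVec, dotProduct_smul,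
      ← mulVec_mulVec, dotProduct_mulVec, vecMul_transpose, smul_eq_mul]
    linarith

theorem exists_le_smul_one {P : Matrix (Fin n) (Fin n) ℝ} (hP : 0 ≤ P) :
    ∃ c : ℝ, 0 < c ∧ P ≤ c • (1 : Matrix (Fin n) (Fin n) ℝ) := by
  obtain ⟨B, rfl⟩ := CStarAlgebra.nonneg_iff_eq_star_mul_self.1 hP
  simpa [star_eq_conjTranspose, conjTranspose_eq_transpose_of_trivial] using
    exists_transpose_mul_self_le_smul_one B

/-- Write `P = Bᵀ * B` with `B` invertible and conjugate an upper bound for `B⁻¹ᵀ * B⁻¹` by `Bᵀ`. -/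
theorem PosDef.exists_smul_one_le {P : Matrix (Fin n) (Fin n) ℝ} (hP : P.PosDef) :
    ∃ c : ℝ, 0 < c ∧ c • (1 : Matrix (Fin n) (Fin n) ℝ) ≤ P := by
  obtain ⟨B, rfl⟩ := CStarAlgebra.nonneg_iff_eq_star_mul_self.1
    (nonneg_iff_posSemidef.2 hP.posSemidef)
  have hB : IsUnit B.det := by
    have := hP.isUnit.map detMonoidHom
    simp only [star_eq_conjTranspose, coe_detMonoidHom, det_mul] at this
    exact isUnit_of_mul_isUnit_right this
  obtain ⟨c, hc, h⟩ := exists_transpose_mul_self_le_smul_one B⁻¹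
  have h' := congruence_le_congruence h Bᵀ
  refine ⟨c⁻¹, inv_pos.2 hc, ?_⟩
  have h1 : Bᵀ * (B⁻¹ᵀ * B⁻¹) * Bᵀᵀ = 1 := by
    rw [← Matrix.mul_assoc, ← transpose_mul, nonsing_inv_mul B hB, transpose_one, Matrix.one_mul,
      transpose_transpose, nonsing_inv_mul B hB]
  rw [h1] at h'
  have := smul_le_smul_left_of_nonneg h' (inv_nonneg.2 hc.le)
  simpa [star_eq_conjTranspose, conjTranspose_eq_transpose_of_trivial, smul_smul, hc.ne'] using this

end Matrix

/-! ### The Riccati map and its contraction property. -/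

namespace SensorSystem

open Matrix
open scoped MatrixOrder

variable {n p M : ℕ} (S : SensorSystem n p M)

/-- The covariance update of sensor `i` under an arbitrary predictor gain `L`. -/
def gainUpdate (i : Fin M) (L : Matrix (Fin n) (Fin p) ℝ) (Q : Matrix (Fin n) (Fin n) ℝ) :
    Matrix (Fin n) (Fin n) ℝ :=
  S.W + (S.A - L * S.C i) * Q * (S.A - L * S.C i)ᵀ + L * S.V i * Lᵀ

/-- The Kalman predictor gain. -/
noncomputable def kalmanGain (i : Fin M) (Q : Matrix (Fin n) (Fin n) ℝ) : Matrix (Fin n) (Fin p) ℝ :=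
  S.A * Q * (S.C i)ᵀ * (S.C i * Q * (S.C i)ᵀ + S.V i)⁻¹

variable {S}

/-- Completing the square in `L`: the excess is a nonnegative quadratic form that vanishes at the
Kalman gain. -/
theorem gainUpdate_eq_riccati_add {i : Fin M} (hV : (S.V i).PosDef)
    {Q : Matrix (Fin n) (Fin n) ℝ} (hQ : 0 ≤ Q) (L : Matrix (Fin n) (Fin p) ℝ) :
    S.gainUpdate i L Q = S.riccati i Q + (L - S.kalmanGain i Q) *
      (S.C i * Q * (S.C i)ᵀ + S.V i) * (L - S.kalmanGain i Q)ᵀ := by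
  have hI : (S.C i * Q * (S.C i)ᵀ + S.V i).PosDef :=
    .posSemidef_add (nonneg_iff_posSemidef.1 (congruence_nonneg hQ _)) hV
  have hdet : IsUnit (S.C i * Q * (S.C i)ᵀ + S.V i).det :=
    (isUnit_iff_isUnit_det _).1 hI.isUnit
  have hIt : (S.C i * Q * (S.C i)ᵀ + S.V i)ᵀ = S.C i * Q * (S.C i)ᵀ + S.V i := hI.isHermitian
  have hQt : Qᵀ = Q := (nonneg_iff_posSemidef.1 hQ).isHermitian
  have e : S.V i = (S.C i * Q * (S.C i)ᵀ + S.V i) - S.C i * Q * (S.C i)ᵀ := by abel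
  unfold gainUpdate riccati kalmanGain
  generalize hR : S.C i * Q * (S.C i)ᵀ + S.V i = R at *
  have h1 : R * R⁻¹ = 1 := mul_nonsing_inv R hdet
  have h2 : R⁻¹ * R = 1 := nonsing_inv_mul R hdet
  rw [e]
  simp only [transpose_sub, transpose_mul, transpose_transpose, transpose_nonsing_inv, hIt, hQt,
    Matrix.sub_mul, Matrix.mul_sub]
  have h3 : ∀ X : Matrix (Fin p) (Fin n) ℝ, R⁻¹ * (R * X) = X := fun X => by
    rw [← Matrix.mul_assoc, h2, Matrix.one_mul]
  have h4 : ∀ X : Matrix (Fin p) (Fin n) ℝ, R * (R⁻¹ * X) = X := fun X => by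
    rw [← Matrix.mul_assoc, h1, Matrix.one_mul]
  simp only [Matrix.mul_assoc, h3, h4]
  abel

theorem riccati_le_gainUpdate {i : Fin M} (hV : (S.V i).PosDef)
    {Q : Matrix (Fin n) (Fin n) ℝ} (hQ : 0 ≤ Q) (L : Matrix (Fin n) (Fin p) ℝ) :
    S.riccati i Q ≤ S.gainUpdate i L Q := by
  rw [gainUpdate_eq_riccati_add hV hQ]
  exact le_add_of_nonneg_right (congruence_nonneg
    (add_nonneg (congruence_nonneg hQ _) (nonneg_iff_posSemidef.2 hV.posSemidef)) _)

theorem gainUpdate_kalmanGain {i : Fin M} (hV : (S.V i).PosDef)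
    {Q : Matrix (Fin n) (Fin n) ℝ} (hQ : 0 ≤ Q) :
    S.gainUpdate i (S.kalmanGain i Q) Q = S.riccati i Q := by
  rw [gainUpdate_eq_riccati_add hV hQ]
  simp

theorem le_riccati {i : Fin M} (hV : (S.V i).PosDef)
    {Q : Matrix (Fin n) (Fin n) ℝ} (hQ : 0 ≤ Q) : S.W ≤ S.riccati i Q := by
  rw [← gainUpdate_kalmanGain hV hQ, gainUpdate, add_assoc]
  exact le_add_of_nonneg_right (add_nonneg (congruence_nonneg hQ _)
    (congruence_nonneg (nonneg_iff_posSemidef.2 hV.posSemidef) _))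

theorem riccati_le {i : Fin M} (hV : (S.V i).PosDef)
    {Q : Matrix (Fin n) (Fin n) ℝ} (hQ : 0 ≤ Q) : S.riccati i Q ≤ S.W + S.A * Q * S.Aᵀ := by
  simpa [gainUpdate] using riccati_le_gainUpdate hV hQ 0

/-- Freeze the gain `L` that is optimal for `P`. Scaling by `1 + κ` should affect only the linear
term, so `(1 + κ) • S.riccati i P` overshoots by `κ • (W + L V Lᵀ)`; the `W` part is kept. The case
`κ = 0` is monotonicity. -/
theorem riccati_le_of_le_smul {i : Fin M} (hV : (S.V i).PosDef)
    {P Q : Matrix (Fin n) (Fin n) ℝ} (hP : 0 ≤ P) (hQ : 0 ≤ Q) {κ : ℝ} (hκ : 0 ≤ κ)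
    (h : Q ≤ (1 + κ) • P) : S.riccati i Q ≤ (1 + κ) • S.riccati i P - κ • S.W := by
  refine (riccati_le_gainUpdate hV hQ (S.kalmanGain i P)).trans ?_
  have h1 := congruence_le_congruence h (S.A - S.kalmanGain i P * S.C i)
  have h2 := (nonneg_iff_posSemidef.2 (((nonneg_iff_posSemidef.1 (congruence_nonneg
    (nonneg_iff_posSemidef.2 hV.posSemidef) (S.kalmanGain i P))).smul hκ)))
  rw [← gainUpdate_kalmanGain hV hP]
  simp only [gainUpdate]
  generalize S.kalmanGain i P = L at *
  rw [mul_smul_comm, smul_mul_assoc] at h1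
  have := add_le_add h1 h2
  rw [← sub_nonneg] at this ⊢
  convert this using 1
  module

/-- The Riccati map contracts the gap `κ` in `Q ≤ (1 + κ) • P` when its value at `P` is bounded. -/
theorem riccati_le_smul_riccati {i : Fin M} (hV : (S.V i).PosDef)
    {P Q : Matrix (Fin n) (Fin n) ℝ} (hP : 0 ≤ P) (hQ : 0 ≤ Q) {κ ε β : ℝ} (hκ : 0 ≤ κ)
    (h : Q ≤ (1 + κ) • P) (hε : 0 < ε) (hW : ε • (1 : Matrix (Fin n) (Fin n) ℝ) ≤ S.W)
    (hβ : 0 < β) (hPβ : S.riccati i P ≤ β • (1 : Matrix (Fin n) (Fin n) ℝ)) :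
    S.riccati i Q ≤ (1 + κ * (1 - ε / β)) • S.riccati i P := by
  refine (riccati_le_of_le_smul hV hP hQ hκ h).trans ?_
  have h1 : (κ * (ε / β)) • S.riccati i P ≤ κ • S.W := by
    have h2 := smul_le_smul_left_of_nonneg hPβ (a := κ * (ε / β)) (by positivity)
    have h3 := smul_le_smul_left_of_nonneg hW hκ
    have h4 : κ * (ε / β) * β = κ * ε := by field_simp
    rw [smul_smul, h4] at h2
    rw [smul_smul] at h3
    exact h2.trans h3
  rw [← sub_nonneg] at h1 ⊢
  convert h1 using 1
  module

end SensorSystem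

/-! ### Comparison of limsups of bounded sequences. -/

theorem limsup_le_limsup_add_of_le_add_div {u v : ℕ → ℝ} {B K b : ℝ} (hu : ∀ m, |u m| ≤ B)
    (hv : ∀ m, |v m| ≤ B) (h : ∀ m : ℕ, 0 < m → u m ≤ v m + K / m + b) :
    limsup u atTop ≤ limsup v atTop + b := by
  refine le_of_forall_pos_le_add fun ε hε => ?_
  have hvb : IsBoundedUnder (· ≤ ·) atTop v :=
    isBoundedUnder_of ⟨B, fun m => (abs_le.1 (hv m)).2⟩
  have huc : IsCoboundedUnder (· ≤ ·) atTop u :=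
    (isBoundedUnder_of ⟨-B, fun m => (abs_le.1 (hu m)).1⟩ :
      IsBoundedUnder (· ≥ ·) atTop u).isCoboundedUnder_le
  have h1 : ∀ᶠ m in atTop, v m < limsup v atTop + ε / 2 :=
    eventually_lt_of_limsup_lt (by linarith) hvb
  have h2 : ∀ᶠ m : ℕ in atTop, K / m < ε / 2 :=
    (tendsto_const_div_atTop_nhds_zero_nat K).eventually (gt_mem_nhds (half_pos hε))
  refine limsup_le_of_le huc ?_
  filter_upwards [h1, h2, eventually_gt_atTop 0] with m hm1 hm2 hm3
  linarith [h m hm3]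

theorem abs_limsup_sub_limsup_le {u v : ℕ → ℝ} {B K b : ℝ} (hu : ∀ m, |u m| ≤ B)
    (hv : ∀ m, |v m| ≤ B) (h : ∀ m : ℕ, 0 < m → |u m - v m| ≤ K / m + b) :
    |limsup u atTop - limsup v atTop| ≤ b := by
  have h1 := limsup_le_limsup_add_of_le_add_div (K := K) (b := b) hu hv fun m hm => by
    linarith [(abs_le.1 (h m hm)).2]
  have h2 := limsup_le_limsup_add_of_le_add_div (K := K) (b := b) hv hu fun m hm => by
    linarith [(abs_le.1 (h m hm)).1]
  rw [abs_le]
  constructor <;> linarith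

/-! ### Trajectories and forgetting of the initial covariance. -/

namespace SensorSystem

open Matrix
open scoped MatrixOrder

variable {n p M : ℕ} {S : SensorSystem n p M} {σ τ : ℕ → Fin M}
  {P Q φ : Matrix (Fin n) (Fin n) ℝ} {β : ℝ}

theorem covariance_add (S : SensorSystem n p M) (σ : ℕ → Fin M) (φ : Matrix (Fin n) (Fin n) ℝ)
    (s t : ℕ) :
    S.covariance σ φ (s + t) = S.covariance (fun k => σ (s + k)) (S.covariance σ φ s) t := by
  induction t with
  | zero => rfl
  | succ t ih => rw [← add_assoc, covariance, covariance, ih]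

theorem covariance_congr {t : ℕ} (h : ∀ k < t, σ k = τ k) :
    S.covariance σ φ t = S.covariance τ φ t := by
  induction t with
  | zero => rfl
  | succ t ih => rw [covariance, covariance, ih fun k hk => h k (by omega), h t (by omega)]

theorem riccati_nonneg (hW : S.W.PosDef) (hV : ∀ i, (S.V i).PosDef) (i : Fin M) (hQ : 0 ≤ Q) :
    0 ≤ S.riccati i Q :=
  (nonneg_iff_posSemidef.2 hW.posSemidef).trans (le_riccati (hV i) hQ)

theorem covariance_nonneg (hW : S.W.PosDef) (hV : ∀ i, (S.V i).PosDef) (σ : ℕ → Fin M)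
    (hQ : 0 ≤ Q) (t : ℕ) : 0 ≤ S.covariance σ Q t := by
  induction t with
  | zero => exact hQ
  | succ t ih => exact riccati_nonneg hW hV _ ih

theorem covariance_mono (hW : S.W.PosDef) (hV : ∀ i, (S.V i).PosDef) (σ : ℕ → Fin M)
    (hP : 0 ≤ P) (hPQ : P ≤ Q) (t : ℕ) : S.covariance σ P t ≤ S.covariance σ Q t := by
  induction t with
  | zero => exact hPQ
  | succ t ih =>
    rw [covariance, covariance]
    simpa using riccati_le_of_le_smul (hV _) (covariance_nonneg hW hV σ (hP.trans hPQ) t)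
      (covariance_nonneg hW hV σ hP t) le_rfl (by simpa using ih)

/-- If the trajectory from `0` is bounded, every other trajectory approaches it geometrically,
uniformly over bounded sets of initial covariances. -/
theorem exists_covariance_le_smul (hW : S.W.PosDef) (hV : ∀ i, (S.V i).PosDef) (hβ : 0 < β)
    (hσ : ∀ t, S.covariance σ 0 t ≤ β • (1 : Matrix (Fin n) (Fin n) ℝ)) (B : ℝ) :
    ∃ κ r : ℝ, 0 ≤ κ ∧ 0 ≤ r ∧ r < 1 ∧ ∀ Q : Matrix (Fin n) (Fin n) ℝ, 0 ≤ Q →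
      Q ≤ B • (1 : Matrix (Fin n) (Fin n) ℝ) → ∀ t,
      S.covariance σ Q (t + 1) ≤ (1 + κ * r ^ t) • S.covariance σ 0 (t + 1) := by
  have h1nn : (0 : Matrix (Fin n) (Fin n) ℝ) ≤ 1 := zero_le_one
  have hWnn : 0 ≤ S.W := nonneg_iff_posSemidef.2 hW.posSemidef
  obtain ⟨ε₀, hε₀, hWε₀⟩ := hW.exists_smul_one_le
  -- Shrinking `ε` below `β` keeps the ratio `1 - ε / β` nonnegative.
  obtain ⟨ε, hε, hεβ, hWε⟩ : ∃ ε : ℝ, 0 < ε ∧ ε ≤ β ∧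
      ε • (1 : Matrix (Fin n) (Fin n) ℝ) ≤ S.W :=
    ⟨min ε₀ β, lt_min hε₀ hβ, min_le_right _ _,
      (smul_le_smul_right_of_posSemidef h1nn (min_le_left _ _)).trans hWε₀⟩
  obtain ⟨c, hc, hAc⟩ := exists_le_smul_one (add_nonneg hWnn (congruence_nonneg
    (smul_le_smul_right_of_posSemidef h1nn (le_max_right B 0) |>.trans' (by simp)) S.A))
  have hr1 : ε / β ≤ 1 := (div_le_one hβ).2 hεβ
  have hr0 : 0 < ε / β := by positivity
  refine ⟨c / ε, 1 - ε / β, by positivity, by linarith, by linarith, fun Q hQ hQB t => ?_⟩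
  induction t with
  | zero =>
    -- The comparison starts at time 1: there the trajectory from `0` dominates `W ≥ ε • 1`, whereas
    -- at time 0 it vanishes.
    have h1 : S.riccati (σ 0) Q ≤ c • (1 : Matrix (Fin n) (Fin n) ℝ) := by
      refine ((riccati_le (hV _) hQ).trans (add_le_add_right ?_ _)).trans hAc
      exact congruence_le_congruence
        (hQB.trans (smul_le_smul_right_of_posSemidef h1nn (le_max_left B 0))) _
    have h2 := smul_le_smul_left_of_nonneg hWε (a := c / ε) (by positivity)
    rw [smul_smul, div_mul_cancel₀ _ hε.ne'] at h2
    have h3 := smul_le_smul_left_of_nonneg (le_riccati (S := S) (hV (σ 0)) le_rfl)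
      (a := c / ε) (by positivity)
    have h4 := smul_le_smul_right_of_posSemidef (riccati_nonneg hW hV (σ 0) le_rfl)
      (show c / ε ≤ 1 + c / ε * (1 - ε / β) ^ 0 by simp)
    exact h1.trans (h2.trans (h3.trans h4))
  | succ t ih =>
    have := riccati_le_smul_riccati (hV (σ (t + 1))) (covariance_nonneg hW hV σ le_rfl (t + 1))
      (covariance_nonneg hW hV σ hQ (t + 1))
      (mul_nonneg (by positivity) (pow_nonneg (by linarith) t)) ih hε hWε hβ (hσ (t + 2))
    rw [pow_succ, ← mul_assoc]
    exact this

/-! ### Costs and their dependence on the initial covariance. -/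

theorem totalCost_succ (S : SensorSystem n p M) (σ : ℕ → Fin M) (φ : Matrix (Fin n) (Fin n) ℝ)
    (k : ℕ) : S.totalCost (k + 1) σ φ = S.totalCost k σ φ + (S.covariance σ φ (k + 1)).trace :=
  Finset.sum_Icc_succ_top (by omega) _

theorem totalCost_zero (S : SensorSystem n p M) (σ : ℕ → Fin M) (φ : Matrix (Fin n) (Fin n) ℝ) :
    S.totalCost 0 σ φ = 0 := by
  simp [totalCost]

theorem totalCost_add (S : SensorSystem n p M) (σ : ℕ → Fin M) (φ : Matrix (Fin n) (Fin n) ℝ)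
    (s t : ℕ) : S.totalCost (s + t) σ φ =
      S.totalCost s σ φ + S.totalCost t (fun k => σ (s + k)) (S.covariance σ φ s) := by
  induction t with
  | zero => simp [totalCost_zero]
  | succ t ih => rw [← add_assoc, totalCost_succ, ih, totalCost_succ, add_assoc s, covariance_add,
      add_assoc]

theorem totalCost_congr {N : ℕ} (h : ∀ k < N, σ k = τ k) :
    S.totalCost N σ φ = S.totalCost N τ φ := by
  refine Finset.sum_congr rfl fun t ht => ?_
  rw [covariance_congr fun k hk => h k (hk.trans_le (Finset.mem_Icc.1 ht).2)]

theorem totalCost_nonneg (hW : S.W.PosDef) (hV : ∀ i, (S.V i).PosDef) (σ : ℕ → Fin M)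
    (hφ : 0 ≤ φ) (N : ℕ) : 0 ≤ S.totalCost N σ φ :=
  Finset.sum_nonneg fun t _ =>
    (nonneg_iff_posSemidef.1 (covariance_nonneg hW hV σ hφ t)).trace_nonneg

theorem totalCost_le (h : ∀ t, S.covariance σ φ t ≤ β • (1 : Matrix (Fin n) (Fin n) ℝ))
    (N : ℕ) : S.totalCost N σ φ ≤ N * (β * n) := by
  have := Finset.sum_le_card_nsmul (Finset.Icc 1 N) (fun t => (S.covariance σ φ t).trace) (β * n)
    fun t _ => trace_le_of_le_smul_one (h t)
  simpa [totalCost] using this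

theorem abs_averageCost_le (hW : S.W.PosDef) (hV : ∀ i, (S.V i).PosDef) (hβ : 0 ≤ β) (hφ : 0 ≤ φ)
    (h : ∀ t, S.covariance σ φ t ≤ β • (1 : Matrix (Fin n) (Fin n) ℝ)) (N : ℕ) :
    |S.averageCost N σ φ| ≤ β * n := by
  have h0 := totalCost_nonneg hW hV σ hφ N
  rw [averageCost, one_div_mul_eq_div, abs_of_nonneg (by positivity)]
  refine div_le_of_le_mul₀ (by positivity) (by positivity) ?_
  linarith [totalCost_le h N]

/-- The trace gaps are dominated by a geometric series, so `K` depends neither on `N` nor on `Q`. -/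
theorem exists_abs_totalCost_sub_le (hW : S.W.PosDef) (hV : ∀ i, (S.V i).PosDef) (hβ : 0 < β)
    (hσ : ∀ t, S.covariance σ 0 t ≤ β • (1 : Matrix (Fin n) (Fin n) ℝ)) (B : ℝ) :
    ∃ K : ℝ, 0 ≤ K ∧ ∀ Q : Matrix (Fin n) (Fin n) ℝ, 0 ≤ Q →
      Q ≤ B • (1 : Matrix (Fin n) (Fin n) ℝ) → ∀ N,
      |S.totalCost N σ Q - S.totalCost N σ 0| ≤ K := by
  obtain ⟨κ, r, hκ, hr, hr1, h⟩ := exists_covariance_le_smul hW hV hβ hσ B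
  have hβn : 0 ≤ β * n := by positivity
  refine ⟨κ * (β * n) * (1 - r)⁻¹, by have := sub_pos.2 hr1; positivity,
    fun Q hQ hQB N => ?_⟩
  have hlow : ∀ t, (S.covariance σ 0 t).trace ≤ (S.covariance σ Q t).trace := fun t =>
    trace_le_trace (covariance_mono hW hV σ le_rfl hQ t)
  have hle : S.totalCost N σ 0 ≤ S.totalCost N σ Q := Finset.sum_le_sum fun t _ => hlow t
  rw [abs_of_nonneg (sub_nonneg.2 hle)]
  have hsum : S.totalCost N σ Q - S.totalCost N σ 0 ≤
      ∑ t ∈ Finset.range N, κ * (β * n) * r ^ t := by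
    clear hle
    induction N with
    | zero => simp [totalCost_zero]
    | succ N ih =>
      rw [totalCost_succ, totalCost_succ, Finset.sum_range_succ]
      have h1 := trace_le_trace (h Q hQ hQB N)
      rw [trace_smul, smul_eq_mul] at h1
      have h2 : κ * r ^ N * (S.covariance σ 0 (N + 1)).trace ≤ κ * r ^ N * (β * n) :=
        mul_le_mul_of_nonneg_left (trace_le_of_le_smul_one (hσ _)) (by positivity)
      linarith
  refine hsum.trans ?_
  rw [← Finset.mul_sum]
  refine mul_le_mul_of_nonneg_left ?_ (by positivity)
  rw [← tsum_geometric_of_lt_one hr hr1]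
  exact (summable_geometric_of_lt_one hr hr1).sum_le_tsum _ fun t _ => pow_nonneg hr t

theorem Feasible.exists_pos_bound (hσ : S.Feasible σ) (hφ : 0 ≤ φ) :
    ∃ β : ℝ, 0 < β ∧ ∀ t, S.covariance σ φ t ≤ β • (1 : Matrix (Fin n) (Fin n) ℝ) := by
  obtain ⟨β, h⟩ := hσ φ (nonneg_iff_posSemidef.1 hφ)
  exact ⟨max β 1, by positivity, fun t =>
    (le_iff.2 (h t)).trans (smul_le_smul_right_of_posSemidef zero_le_one (le_max_left _ _))⟩

theorem feasible_of_covariance_zero_le (hW : S.W.PosDef) (hV : ∀ i, (S.V i).PosDef) (hβ : 0 < β)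
    (hσ : ∀ t, S.covariance σ 0 t ≤ β • (1 : Matrix (Fin n) (Fin n) ℝ)) : S.Feasible σ := by
  intro φ hφ
  obtain ⟨B, hB, hφB⟩ := exists_le_smul_one (nonneg_iff_posSemidef.2 hφ)
  obtain ⟨κ, r, hκ, hr, hr1, h⟩ := exists_covariance_le_smul hW hV hβ hσ B
  refine ⟨max B ((1 + κ) * β), fun t => le_iff.1 ?_⟩
  cases t with
  | zero => exact hφB.trans (smul_le_smul_right_of_posSemidef zero_le_one (le_max_left _ _))
  | succ t =>
    have h1 := smul_le_smul_left_of_nonneg (hσ (t + 1)) (a := 1 + κ * r ^ t) (by positivity)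
    rw [smul_smul] at h1
    refine (h φ (nonneg_iff_posSemidef.2 hφ) hφB t).trans (h1.trans
      (smul_le_smul_right_of_posSemidef zero_le_one ((le_max_right _ _).trans' ?_)))
    have := mul_le_of_le_one_right hκ (pow_le_one₀ hr hr1.le (n := t))
    gcongr

theorem Feasible.infiniteCost_eq (hσ : S.Feasible σ) (hW : S.W.PosDef)
    (hV : ∀ i, (S.V i).PosDef) (hφ : 0 ≤ φ) :
    S.infiniteCost σ φ = S.infiniteCost σ 0 := by
  obtain ⟨β, hβ, h0⟩ := hσ.exists_pos_bound le_rfl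
  obtain ⟨β', hβ', hb⟩ := hσ.exists_pos_bound hφ
  obtain ⟨B, -, hφB⟩ := exists_le_smul_one hφ
  obtain ⟨K, -, h⟩ := exists_abs_totalCost_sub_le hW hV hβ h0 B
  refine sub_eq_zero.1 (abs_nonpos_iff.1 (abs_limsup_sub_limsup_le (B := max (β * n) (β' * n))
    (K := K) ?_ ?_ ?_))
  · exact fun m => (abs_averageCost_le hW hV hβ'.le hφ hb m).trans (le_max_right _ _)
  · exact fun m => (abs_averageCost_le hW hV hβ.le le_rfl h0 m).trans (le_max_left _ _)
  · intro m hm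
    have hm' : (0 : ℝ) < m := by exact_mod_cast hm
    rw [averageCost, averageCost, ← mul_sub, abs_mul, abs_of_pos (by positivity), add_zero,
      one_div_mul_eq_div]
    gcongr
    exact h φ hφ hφB m

/-! ### Periodic repetition of a prefix. -/

/-- The schedule that repeats the first `N` values of `σ`. -/
def repeatPrefix (σ : ℕ → Fin M) (N : ℕ) (t : ℕ) : Fin M := σ (t % N)

theorem periodic_repeatPrefix (σ : ℕ → Fin M) (N : ℕ) :
    Function.Periodic (repeatPrefix σ N) N := fun t => by simp [repeatPrefix]

theorem repeatPrefix_mul_add (σ : ℕ → Fin M) (N k : ℕ) :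
    (fun j => repeatPrefix σ N (N * k + j)) = repeatPrefix σ N := by
  ext j
  simp [repeatPrefix]

theorem repeatPrefix_of_lt (σ : ℕ → Fin M) {N t : ℕ} (h : t < N) : repeatPrefix σ N t = σ t := by
  rw [repeatPrefix, Nat.mod_eq_of_lt h]

theorem covariance_repeatPrefix (S : SensorSystem n p M) (σ : ℕ → Fin M)
    (φ : Matrix (Fin n) (Fin n) ℝ) (N k : ℕ) {j : ℕ} (hj : j ≤ N) :
    S.covariance (repeatPrefix σ N) φ (N * k + j) =
      S.covariance σ (S.covariance (repeatPrefix σ N) φ (N * k)) j := by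
  rw [covariance_add, repeatPrefix_mul_add]
  exact covariance_congr fun i hi => repeatPrefix_of_lt σ (hi.trans_le hj)

theorem totalCost_repeatPrefix (S : SensorSystem n p M) (σ : ℕ → Fin M)
    (φ : Matrix (Fin n) (Fin n) ℝ) (N k : ℕ) {j : ℕ} (hj : j ≤ N) :
    S.totalCost (N * k + j) (repeatPrefix σ N) φ = S.totalCost (N * k) (repeatPrefix σ N) φ +
      S.totalCost j σ (S.covariance (repeatPrefix σ N) φ (N * k)) := by
  rw [totalCost_add, repeatPrefix_mul_add]
  congr 1
  exact totalCost_congr fun i hi => repeatPrefix_of_lt σ (hi.trans_le hj)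

/-- Repeating a long prefix of a feasible schedule keeps the trajectory bounded, and its average
cost stays within `K / N` of that of the prefix, up to a vanishing term. -/
theorem Feasible.exists_repeatPrefix_bound (hσ : S.Feasible σ) (hW : S.W.PosDef)
    (hV : ∀ i, (S.V i).PosDef) :
    ∃ K : ℝ, ∀ᶠ N : ℕ in atTop, S.Feasible (repeatPrefix σ N) ∧
      |S.infiniteCost (repeatPrefix σ N) 0 - S.averageCost N σ 0| ≤ K / N := by
  obtain ⟨β, hβ, h0⟩ := hσ.exists_pos_bound le_rfl
  -- The radius `2 * β` is fixed before `N`. The ball is preserved over one period as soon as `κ * r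
  -- ^ (N - 1) ≤ 1`, since then `(1 + κ * r ^ (N - 1)) * β ≤ 2 * β`.
  obtain ⟨κ, r, hκ, hr, hr1, hc⟩ := exists_covariance_le_smul hW hV hβ h0 (2 * β)
  obtain ⟨K, hK, hcost⟩ := exists_abs_totalCost_sub_le hW hV hβ h0 (2 * β)
  have hlim : Tendsto (fun N : ℕ => κ * r ^ (N - 1)) atTop (nhds 0) := by
    simpa using ((tendsto_pow_atTop_nhds_zero_of_lt_one hr hr1).comp
      (tendsto_sub_atTop_nat 1)).const_mul κ
  refine ⟨K, ?_⟩
  filter_upwards [hlim.eventually (ge_mem_nhds one_pos), eventually_gt_atTop 0] with N hN hN0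
  have hN' : (0 : ℝ) < N := by exact_mod_cast hN0
  have hβn : 0 ≤ β * n := by positivity
  have hbdd : ∀ (Q : Matrix (Fin n) (Fin n) ℝ), 0 ≤ Q →
      Q ≤ (2 * β) • (1 : Matrix (Fin n) (Fin n) ℝ) → ∀ t,
      S.covariance σ Q (t + 1) ≤ ((1 + κ * r ^ t) * β) • (1 : Matrix (Fin n) (Fin n) ℝ) := by
    intro Q hQ hQB t
    have h1 := smul_le_smul_left_of_nonneg (h0 (t + 1)) (a := 1 + κ * r ^ t) (by positivity)
    rw [smul_smul] at h1
    exact (hc Q hQ hQB t).trans h1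
  have hnn : ∀ t, 0 ≤ S.covariance (repeatPrefix σ N) 0 t :=
    covariance_nonneg hW hV (repeatPrefix σ N) le_rfl
  have hperiod : ∀ k, S.covariance (repeatPrefix σ N) 0 (N * k) ≤
      (2 * β) • (1 : Matrix (Fin n) (Fin n) ℝ) := by
    intro k
    induction k with
    | zero =>
      exact (h0 0).trans (smul_le_smul_right_of_posSemidef zero_le_one (by linarith))
    | succ k ih =>
      rw [Nat.mul_succ, covariance_repeatPrefix S σ 0 N k le_rfl]
      have h1 := hbdd _ (hnn _) ih (N - 1)
      rw [Nat.sub_add_cancel hN0] at h1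
      refine h1.trans (smul_le_smul_right_of_posSemidef zero_le_one ?_)
      have : 1 + κ * r ^ (N - 1) ≤ 2 := by linarith
      gcongr
  have hall : ∀ t, S.covariance (repeatPrefix σ N) 0 t ≤
      ((2 + κ) * β) • (1 : Matrix (Fin n) (Fin n) ℝ) := by
    intro t
    rw [← Nat.div_add_mod t N, covariance_repeatPrefix S σ 0 N _ (Nat.mod_lt t hN0).le]
    cases t % N with
    | zero =>
      refine (hperiod _).trans (smul_le_smul_right_of_posSemidef zero_le_one ?_)
      gcongr
      linarith
    | succ j =>
      refine (hbdd _ (hnn _) (hperiod _) j).trans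
        (smul_le_smul_right_of_posSemidef zero_le_one ?_)
      have := mul_le_of_le_one_right hκ (pow_le_one₀ hr hr1.le (n := j))
      gcongr
      linarith
  refine ⟨feasible_of_covariance_zero_le hW hV (by positivity) hall, ?_⟩
  set a := S.averageCost N σ 0 with ha
  have haN : S.totalCost N σ 0 = N * a := by
    rw [ha, averageCost]
    field_simp
  have ha0 : |a| ≤ β * n := abs_averageCost_le hW hV hβ.le le_rfl h0 N
  -- Each full period costs `N * a` up to an error `K`.
  have hmul : ∀ k : ℕ,
      |S.totalCost (N * k) (repeatPrefix σ N) 0 - (N * k : ℕ) * a| ≤ k * K := by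
    intro k
    induction k with
    | zero => simp [totalCost_zero]
    | succ k ih =>
      have h1 := hcost _ (hnn _) (hperiod k) N
      rw [Nat.mul_succ, totalCost_repeatPrefix S σ 0 N k le_rfl]
      rw [haN] at h1
      push_cast at ih ⊢
      rw [abs_le] at *
      constructor <;> linarith
  -- The incomplete last period adds `K` for its initial covariance and a crude `2 * N * (β * n)`;
  -- both vanish after division by `m`.
  have hgen : ∀ m : ℕ, |S.totalCost m (repeatPrefix σ N) 0 - m * a| ≤
      m / N * K + (K + 2 * N * (β * n)) := by
    intro m
    have hj := (Nat.mod_lt m hN0).le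
    have hk : ((m / N : ℕ) : ℝ) ≤ m / N := Nat.cast_div_le
    have h1 := hmul (m / N)
    have h2 := hcost _ (hnn _) (hperiod (m / N)) (m % N)
    have h3 := totalCost_repeatPrefix S σ 0 N (m / N) hj
    rw [Nat.div_add_mod] at h3
    have h4 : (m : ℝ) = (N * (m / N) : ℕ) + (m % N : ℕ) := by
      exact_mod_cast (Nat.div_add_mod m N).symm
    have h5 : |S.totalCost (m % N) σ 0 - (m % N : ℕ) * a| ≤ 2 * N * (β * n) := by
      have e1 := totalCost_nonneg hW hV σ (le_refl (0 : Matrix (Fin n) (Fin n) ℝ)) (m % N)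
      have e2 := totalCost_le h0 (m % N)
      have e3 : ((m % N : ℕ) : ℝ) * (β * n) ≤ N * (β * n) := by gcongr
      have e4 : |((m % N : ℕ) : ℝ) * a| ≤ (m % N : ℕ) * (β * n) := by
        rw [abs_mul, Nat.abs_cast]
        gcongr
      rw [abs_le] at *
      constructor <;> linarith
    have h6 : ((m / N : ℕ) : ℝ) * K ≤ m / N * K := by gcongr
    have h7 : (m : ℝ) * a = (N * (m / N) : ℕ) * a + (m % N : ℕ) * a := by
      rw [← add_mul, ← h4]
    rw [h3, h7]
    rw [abs_le] at *
    constructor <;> linarith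
  have hconst : limsup (fun _ : ℕ => a) atTop = a := limsup_const a
  rw [← hconst]
  refine abs_limsup_sub_limsup_le (B := max ((2 + κ) * β * n) (β * n))
    (K := K + 2 * N * (β * n)) ?_ ?_ ?_
  · exact fun m => (abs_averageCost_le hW hV (by positivity) le_rfl hall m).trans (le_max_left _ _)
  · exact fun m => ha0.trans (le_max_right _ _)
  · intro m hm
    have hm' : (0 : ℝ) < m := by exact_mod_cast hm
    have e : S.averageCost m (repeatPrefix σ N) 0 - a =
        (S.totalCost m (repeatPrefix σ N) 0 - m * a) / m := by
      rw [averageCost]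
      field_simp
    rw [e, abs_div, abs_of_pos hm', div_le_iff₀ hm']
    refine (hgen m).trans (le_of_eq ?_)
    field_simp
    ring

/-- Averages are eventually below the limsup plus `ε`, but only frequently above the limsup minus
`ε`. -/
theorem Feasible.frequently_abs_averageCost_sub_lt (hσ : S.Feasible σ) (hW : S.W.PosDef)
    (hV : ∀ i, (S.V i).PosDef) {ε : ℝ} (hε : 0 < ε) :
    ∃ᶠ N in atTop, |S.averageCost N σ 0 - S.infiniteCost σ 0| < ε := by
  obtain ⟨β, hβ, h0⟩ := hσ.exists_pos_bound le_rfl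
  have hb : ∀ m, |S.averageCost m σ 0| ≤ β * n := abs_averageCost_le hW hV hβ.le le_rfl h0
  have hu : IsBoundedUnder (· ≤ ·) atTop fun m => S.averageCost m σ 0 :=
    isBoundedUnder_of ⟨β * n, fun m => (abs_le.1 (hb m)).2⟩
  have hl : IsCoboundedUnder (· ≤ ·) atTop fun m => S.averageCost m σ 0 :=
    (isBoundedUnder_of ⟨-(β * n), fun m => (abs_le.1 (hb m)).1⟩ :
      IsBoundedUnder (· ≥ ·) atTop fun m => S.averageCost m σ 0).isCoboundedUnder_le
  have h1 : ∀ᶠ m in atTop, S.averageCost m σ 0 < S.infiniteCost σ 0 + ε :=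
    eventually_lt_of_limsup_lt (lt_add_of_pos_right _ hε) hu
  have h2 : ∃ᶠ m in atTop, S.infiniteCost σ 0 - ε < S.averageCost m σ 0 :=
    frequently_lt_of_lt_limsup hl (sub_lt_self _ hε)
  refine (h2.and_eventually h1).mono fun m hm => ?_
  rw [abs_lt]
  constructor <;> linarith [hm.1, hm.2]

end SensorSystem

theorem mainTheorem1 {n p M : ℕ} (S : SensorSystem n p M)
    (hW : S.W.PosDef) (hV : ∀ i : Fin M, (S.V i).PosDef)
    (σ : ℕ → Fin M) (hσ : S.Feasible σ) (δ : ℝ) (hδ : 0 < δ) :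
    ∃ (N : ℕ) (τ : ℕ → Fin M), 0 < N ∧ Function.Periodic τ N ∧ S.Feasible τ ∧
      ∀ φ ψ : Matrix (Fin n) (Fin n) ℝ, φ.PosSemidef → ψ.PosSemidef →
        |S.infiniteCost τ φ - S.infiniteCost σ ψ| < δ := by
  obtain ⟨K, hK⟩ := hσ.exists_repeatPrefix_bound hW hV
  have hlim : ∀ᶠ N : ℕ in atTop, K / N < δ / 2 :=
    (tendsto_const_div_atTop_nhds_zero_nat K).eventually (gt_mem_nhds (half_pos hδ))
  obtain ⟨N, hN, ⟨hτ, hcost⟩, hKN, hN0⟩ :=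
    ((hσ.frequently_abs_averageCost_sub_lt hW hV (half_pos hδ)).and_eventually
      (hK.and (hlim.and (eventually_gt_atTop 0)))).exists
  refine ⟨N, SensorSystem.repeatPrefix σ N, hN0, SensorSystem.periodic_repeatPrefix σ N, hτ, fun φ ψ hφ hψ => ?_⟩
  rw [hτ.infiniteCost_eq hW hV (Matrix.nonneg_iff_posSemidef.2 hφ),
    hσ.infiniteCost_eq hW hV (Matrix.nonneg_iff_posSemidef.2 hψ)]
  have := abs_sub_le (S.infiniteCost (SensorSystem.repeatPrefix σ N) 0) (S.averageCost N σ 0)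
    (S.infiniteCost σ 0)
  linarith
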